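/- A ranked alphabet $\Sigma$ is a finite set of symbols, each with a rank in $\mathbb{N}$; $T_\Sigma(X)$ is the set of terms over $\Sigma$ with variables in $X=\{x_1,x_2,\dots\}$, and $T_\Sigma$ is the set of ground terms. A term rewrite system (TRS) over $\Sigma$ is a finite set $R\subseteq T_\Sigma(X)\times T_\Sigma(X)$ of rules $l\to r$ such that every variable of $r$ occurs in $l$. For $L\subseteq T_\Sigma$ let $R^*_\Sigma(L)=\{p\in T_\Sigma : q\to_R^* p\text{ for some }q\in L\}$. The TRS $R$ is monadic if every left-hand side has height at least $1$ and every right-hand side has height at most $1$ (variables and constants have height $0$); it is right-ground if every right-hand side is ground; it is murg if it is the union of a monadic TRS and a right-ground TRS over $\Sigma$. The TRS $R$ over $\Sigma$ preserves $\Sigma$-recognizability of finite tree languages if for every finite $L\subseteq T_\Sigma$ the tree language $R^*_\Sigma(L)$ is recognizable, i.e. recognized by a (finite, nondeterministic) bottom-up tree automaton over $\Sigma$. Proposition. The following problem is undecidable. Instance: a ranked alphabet $\Sigma$ and a murg TRS $R$ over $\Sigma$ (given by the list of the ranks of the symbols of $\Sigma$ and a list of the rules of $R$, with terms written in prefix notation).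 Question: does $R$ preserve $\Sigma$-recognizability of finite tree languages? -/

import Mathlib

/-- A ranked alphabet: a finite set of symbols, each with a unique rank. Up to renaming, the
symbols are `0, …, size - 1`. -/
structure RankedAlphabet where
  size : ℕ
  rank : Fin size → ℕ

/-- `Term F V` is the set `T_F(V)` of terms (trees) over the ranked alphabet `F` with variables
in `V`. -/
inductive RankedAlphabet.Term (F : RankedAlphabet) (V : Type) : Type
  | var (x : V) : RankedAlphabet.Term F V
  | app (f : Fin F.size) (ts : Fin (F.rank f) → RankedAlphabet.Term F V) :
      RankedAlphabet.Term F V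

namespace RankedAlphabet

/-- The set of variables occurring in a term. -/
def Term.vars {F : RankedAlphabet} {V : Type} : F.Term V → Set V
  | .var x => {x}
  | .app _ ts => ⋃ i, (ts i).vars

/-- The height of a term; variables and constants have height `0`. -/
def Term.height {F : RankedAlphabet} {V : Type} : F.Term V → ℕ
  | .var _ => 0
  | .app _ ts => Finset.univ.sup fun i => (ts i).height + 1

/-- Simultaneous substitution of terms for variables. -/
def Term.subst {F : RankedAlphabet} {V W : Type} (σ : V → F.Term W) : F.Term V → F.Term W
  | .var x => σ x
  | .app f ts => .app f fun i => (ts i).subst σ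

/-- Ground terms, the elements of `T_F`. -/
abbrev GroundTerm (F : RankedAlphabet) : Type := F.Term Empty

/-- A pair `(l, r)` of terms over the fixed countable set of variables `x₀, x₁, …`. -/
abbrev Rule (F : RankedAlphabet) : Type := F.Term ℕ × F.Term ℕ

/-- A term rewrite system over `F`: a finite set of rules `(l, r)` such that each variable of `r`
occurs in `l`. -/
structure TRS (F : RankedAlphabet) where
  rules : Set F.Rule
  finite : rules.Finite
  vars_subset : ∀ ρ ∈ rules, ρ.2.vars ⊆ ρ.1.vars

/-- One rewrite step on `T_F(V)`: an instance `σ(l)` of a left-hand side, at some position, is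
replaced by `σ(r)`. -/
inductive TRS.Step {F : RankedAlphabet} (R : F.TRS) {V : Type} : F.Term V → F.Term V → Prop
  | root (ρ : F.Rule) (hρ : ρ ∈ R.rules) (σ : ℕ → F.Term V) :
      TRS.Step R (ρ.1.subst σ) (ρ.2.subst σ)
  | arg (f : Fin F.size) (ts : Fin (F.rank f) → F.Term V) (i : Fin (F.rank f)) (s : F.Term V)
      (h : TRS.Step R (ts i) s) :
      TRS.Step R (.app f ts) (.app f (Function.update ts i s))

/-- The set `R*(L)` of descendants of the trees in `L`. -/
def TRS.descendants {F : RankedAlphabet} (R : F.TRS) (L : Set F.GroundTerm) :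
    Set F.GroundTerm :=
  {p | ∃ q ∈ L, Relation.ReflTransGen R.Step q p}

/-- Each left-hand side has height at least `1`, each right-hand side height at most `1`. -/
def TRS.IsMonadic {F : RankedAlphabet} (R : F.TRS) : Prop :=
  ∀ ρ ∈ R.rules, 1 ≤ ρ.1.height ∧ ρ.2.height ≤ 1

/-- Each right-hand side is ground. -/
def TRS.IsRightGround {F : RankedAlphabet} (R : F.TRS) : Prop :=
  ∀ ρ ∈ R.rules, ρ.2.vars = ∅

/-- A murg TRS: the union of a monadic and a right-ground TRS over the same ranked alphabet. -/
def TRS.IsMurg {F : RankedAlphabet} (R : F.TRS) : Prop :=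
  ∃ M G : F.TRS, M.IsMonadic ∧ G.IsRightGround ∧ R.rules = M.rules ∪ G.rules

/-- A (nondeterministic) bottom-up tree automaton over `F` with set of states `A`:
`trans f q a` is the rule `f(q₁, …, qₙ) → a` and `eps a b` is the `λ`-rule `a → b`. -/
structure BTA (F : RankedAlphabet) (A : Type) where
  trans : (f : Fin F.size) → (Fin (F.rank f) → A) → A → Prop
  eps : A → A → Prop
  final : Set A

/-- `B.Reaches t a`: the automaton can evaluate the ground term `t` to the state `a`. -/
inductive BTA.Reaches {F : RankedAlphabet} {A : Type} (B : F.BTA A) : F.GroundTerm → A → Prop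
  | trans (f : Fin F.size) (ts : Fin (F.rank f) → F.GroundTerm) (q : Fin (F.rank f) → A) (a : A)
      (hq : ∀ i, BTA.Reaches B (ts i) (q i)) (h : B.trans f q a) :
      BTA.Reaches B (.app f ts) a
  | eps (t : F.GroundTerm) (a b : A) (ha : BTA.Reaches B t a) (h : B.eps a b) :
      BTA.Reaches B t b

/-- The tree language recognized by a bottom-up tree automaton. -/
def BTA.language {F : RankedAlphabet} {A : Type} (B : F.BTA A) : Set F.GroundTerm :=
  {t | ∃ a ∈ B.final, B.Reaches t a}

/-- A tree language is recognizable if a bottom-up tree automaton with finitely many states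
recognizes it. -/
def Recognizable {F : RankedAlphabet} (L : Set F.GroundTerm) : Prop :=
  ∃ (A : Type) (_ : Finite A) (B : F.BTA A), B.language = L

/-- `R` preserves `F`-recognizability of finite tree languages. -/
def TRS.PreservesFiniteRecognizability {F : RankedAlphabet} (R : F.TRS) : Prop :=
  ∀ L : Set F.GroundTerm, L.Finite → Recognizable (R.descendants L)

/-- Terms written as words in prefix notation: `Sum.inl x` stands for the variable `x` and
`Sum.inr f` for the symbol `f`. -/
def Term.code {F : RankedAlphabet} : F.Term ℕ → List (ℕ ⊕ ℕ)
  | .var x => [Sum.inl x]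
  | .app f ts => Sum.inr (f : ℕ) :: (List.ofFn fun i => (ts i).code).flatten

/-- The input presented to an algorithm: the list of the ranks of the symbols, and a list of
rules, each side of a rule being a word. -/
abbrev InstanceCode : Type := List ℕ × List (List (ℕ ⊕ ℕ) × List (ℕ ⊕ ℕ))

/-- The input that presents the ranked alphabet `F` together with the rules in `rs`. -/
def instanceCode (F : RankedAlphabet) (rs : List F.Rule) : InstanceCode :=
  (List.ofFn F.rank, rs.map fun ρ => (ρ.1.code, ρ.2.code))

end RankedAlphabet

/-!
A machine is given by a list of rules, applied at the root only, a start configuration and a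
pattern for the halting configurations. The system built from it first guesses two histories
independently of each other, each of them a list of configurations that begins with the start
configuration, and passes to the verification if they are equal. One step of the verification
compares the first two entries of the first copy with one of the rules and discards the first entry
of both copies. The variable for the rest of the list is bound in the second copy, where it has
depth one, so that the right-hand side is flat, and because the result again consists of two copies
of that rest, the verification can go on. All other rules have ground right-hand sides. Two of them
discard everything and guess again.

If the machine reaches an instance of the pattern, then a correct history leads to a constant that
rewrites to every ground term, and the descendants of every finite language are recognizable.
Otherwise the verification is only ever started on two equal terms of unbounded size, and comparing
such terms is beyond a finite automaton. For an evaluator of partial recursive functions as the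
machine, deciding which of the two cases holds would decide the halting problem.
-/

namespace RankedAlphabet

open Relation (ReflTransGen)

variable {F : RankedAlphabet} {U V W : Type}

namespace Term

theorem subst_app (σ : V → F.Term W) (f : Fin F.size) (ts : Fin (F.rank f) → F.Term V) :
    (app f ts).subst σ = app f fun i => (ts i).subst σ := by
  simp only [subst]

theorem vars_app (f : Fin F.size) (ts : Fin (F.rank f) → F.Term V) :
    (app f ts).vars = ⋃ i, (ts i).vars := by
  simp only [vars]

theorem height_app (f : Fin F.size) (ts : Fin (F.rank f) → F.Term V) :
    (app f ts).height = Finset.univ.sup fun i => (ts i).height + 1 := by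
  simp only [height]

theorem code_app (f : Fin F.size) (ts : Fin (F.rank f) → F.Term ℕ) :
    (app f ts).code = Sum.inr (f : ℕ) :: (List.ofFn fun i => (ts i).code).flatten := by
  simp only [code]

@[simp] theorem subst_var (σ : V → F.Term W) (x : V) : (var x : F.Term V).subst σ = σ x := rfl

@[simp] theorem vars_var (x : V) : (var x : F.Term V).vars = {x} := by
  simp only [vars]

theorem subst_subst (τ : V → F.Term W) (σ : U → F.Term V) (t : F.Term U) :
    (t.subst σ).subst τ = t.subst fun x => (σ x).subst τ := by
  induction t with
  | var x => rfl
  | app f ts ih => simp only [subst_app, ih]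

theorem subst_eq_self_of_isEmpty [IsEmpty V] (σ : V → F.Term V) (t : F.Term V) :
    t.subst σ = t := by
  induction t with
  | var x => exact isEmptyElim x
  | app f ts ih => simp only [subst_app, ih]

/-- A ground term regarded as a term over an arbitrary set of variables. -/
def ofGround (t : F.GroundTerm) : F.Term V :=
  t.subst Empty.elim

@[simp] theorem subst_ofGround (σ : V → F.Term W) (t : F.GroundTerm) :
    (ofGround t).subst σ = ofGround t := by
  rw [ofGround, subst_subst]
  exact congrArg (t.subst ·) (funext fun x => x.elim)

@[simp] theorem ofGround_eq_self (t : F.GroundTerm) : (ofGround t : F.GroundTerm) = t :=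
  subst_eq_self_of_isEmpty _ t

@[simp] theorem vars_ofGround (t : F.GroundTerm) : (ofGround t : F.Term V).vars = ∅ := by
  induction t with
  | var x => exact x.elim
  | app f ts ih => simpa only [ofGround, subst_app, vars_app, Set.iUnion_eq_empty] using ih

/-- `t.IsOver S`: every symbol occurring in `t` belongs to `S`. -/
def IsOver (S : Set (Fin F.size)) : F.Term V → Prop
  | .var _ => True
  | .app f ts => f ∈ S ∧ ∀ i, (ts i).IsOver S

variable {S T : Set (Fin F.size)}

@[simp] theorem isOver_var (x : V) : (var x : F.Term V).IsOver S := by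
  simp only [IsOver]

theorem isOver_app {f : Fin F.size} {ts : Fin (F.rank f) → F.Term V} :
    (app f ts).IsOver S ↔ f ∈ S ∧ ∀ i, (ts i).IsOver S := by
  simp only [IsOver]

theorem IsOver.mono (hST : S ⊆ T) {t : F.Term V} (ht : t.IsOver S) : t.IsOver T := by
  induction t with
  | var x => exact isOver_var x
  | app f ts ih =>
    rw [isOver_app] at ht ⊢
    exact ⟨hST ht.1, fun i => ih i (ht.2 i)⟩

theorem isOver_univ (t : F.Term V) : t.IsOver Set.univ := by
  induction t with
  | var x => exact isOver_var x
  | app f ts ih => exact isOver_app.2 ⟨trivial, ih⟩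

theorem IsOver.inter {t : F.Term V} (hS : t.IsOver S) (hT : t.IsOver T) : t.IsOver (S ∩ T) := by
  induction t with
  | var x => exact isOver_var x
  | app f ts ih =>
    rw [isOver_app] at hS hT ⊢
    exact ⟨⟨hS.1, hT.1⟩, fun i => ih i (hS.2 i) (hT.2 i)⟩

theorem isOver_subst {σ : V → F.Term W} {t : F.Term V} :
    (t.subst σ).IsOver S ↔ t.IsOver S ∧ ∀ x ∈ t.vars, (σ x).IsOver S := by
  induction t with
  | var x => simp
  | app f ts ih =>
    simp only [subst_app, isOver_app, vars_app, Set.mem_iUnion, ih]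
    grind

/-- The subterms of a term, the term itself included. -/
def subterms : F.Term V → Set (F.Term V)
  | .var x => {.var x}
  | .app f ts => insert (.app f ts) (⋃ i, (ts i).subterms)

theorem subterms_app (f : Fin F.size) (ts : Fin (F.rank f) → F.Term V) :
    (app f ts).subterms = insert (app f ts) (⋃ i, (ts i).subterms) := by
  simp only [subterms]

theorem mem_subterms_self (t : F.Term V) : t ∈ t.subterms := by
  cases t <;> simp [subterms]

theorem finite_subterms (t : F.Term V) : t.subterms.Finite := by
  induction t with
  | var x => simp [subterms]
  | app f ts ih =>
    rw [subterms_app]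
    exact (Set.finite_iUnion ih).insert _

theorem arg_mem_subterms {f : Fin F.size} {ts : Fin (F.rank f) → F.Term V} {t : F.Term V}
    (h : app f ts ∈ t.subterms) (i : Fin (F.rank f)) : ts i ∈ t.subterms := by
  induction t with
  | var x => simp [subterms] at h
  | app g us ih =>
    rw [subterms_app] at h ⊢
    rcases h with h | h
    · cases h
      exact .inr (Set.mem_iUnion.2 ⟨i, mem_subterms_self _⟩)
    · obtain ⟨j, hj⟩ := Set.mem_iUnion.1 h
      exact .inr (Set.mem_iUnion.2 ⟨j, ih j hj⟩)

theorem IsOver.of_mem_subterms {s t : F.Term V} (ht : t.IsOver S) (hs : s ∈ t.subterms) :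
    s.IsOver S := by
  induction t with
  | var x =>
    obtain rfl : s = var x := by simpa [subterms] using hs
    exact ht
  | app f ts ih =>
    rw [subterms_app] at hs
    rcases hs with rfl | hs
    · exact ht
    · obtain ⟨i, hi⟩ := Set.mem_iUnion.1 hs
      exact ih i ((isOver_app.1 ht).2 i) hi

/-- The term that consists of the constant `c`. -/
def const (c : Fin F.size) (hc : F.rank c = 0) : F.Term V :=
  app c fun i => (i.cast hc).elim0

/-- The term `p(s, t)` for a binary symbol `p`. -/
def bin (p : Fin F.size) (hp : F.rank p = 2) (s t : F.Term V) : F.Term V :=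
  app p fun i => ![s, t] (i.cast hp)

section ConstBin

variable {c d p q : Fin F.size} {hc : F.rank c = 0} {hd : F.rank d = 0} {hp : F.rank p = 2}
  {hq : F.rank q = 2}

theorem app_eq_const (hc : F.rank c = 0) (ts : Fin (F.rank c) → F.Term V) :
    app c ts = const c hc :=
  congrArg (app c) (funext fun i => (i.cast hc).elim0)

theorem app_eq_bin (hp : F.rank p = 2) (ts : Fin (F.rank p) → F.Term V) :
    app p ts = bin p hp (ts (Fin.cast hp.symm 0)) (ts (Fin.cast hp.symm 1)) :=
  congrArg (app p) (funext fun i => by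
    obtain ⟨j, rfl⟩ : ∃ j, i = Fin.cast hp.symm j := ⟨i.cast hp, rfl⟩
    fin_cases j <;> rfl)

theorem forall_arg_bin (hp : F.rank p = 2) {s t : F.Term V} {P : F.Term V → Prop} :
    (∀ i : Fin (F.rank p), P (![s, t] (i.cast hp))) ↔ P s ∧ P t :=
  (finCongr hp).forall_congr_left.trans Fin.forall_fin_two

@[simp] theorem const_inj : (const c hc : F.Term V) = const d hd ↔ c = d :=
  ⟨fun h => (app.inj h).1, fun h => by subst h; rfl⟩

@[simp] theorem const_ne_bin (s t : F.Term V) : const c hc ≠ bin p hp s t := by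
  intro h
  obtain rfl := (app.inj h).1
  omega

@[simp] theorem bin_ne_const (s t : F.Term V) : bin p hp s t ≠ const c hc :=
  (const_ne_bin s t).symm

@[simp] theorem bin_inj {s t s' t' : F.Term V} :
    bin p hp s t = bin q hq s' t' ↔ p = q ∧ s = s' ∧ t = t' := by
  refine ⟨fun h => ?_, by rintro ⟨rfl, rfl, rfl⟩; rfl⟩
  obtain ⟨rfl, h⟩ := app.inj h
  have h := congrFun (eq_of_heq h)
  exact ⟨rfl, h (Fin.cast hp.symm 0), h (Fin.cast hp.symm 1)⟩

@[simp] theorem subst_const (σ : V → F.Term W) : (const c hc).subst σ = const c hc := by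
  rw [const, subst_app]
  exact app_eq_const hc _

@[simp] theorem subst_bin (σ : V → F.Term W) (s t : F.Term V) :
    (bin p hp s t).subst σ = bin p hp (s.subst σ) (t.subst σ) := by
  rw [bin, subst_app]
  exact app_eq_bin hp _

@[simp] theorem ofGround_const : (ofGround (const c hc) : F.Term V) = const c hc :=
  subst_const _

@[simp] theorem ofGround_bin (s t : F.GroundTerm) :
    (ofGround (bin p hp s t) : F.Term V) = bin p hp (ofGround s) (ofGround t) :=
  subst_bin _ s t

@[simp] theorem vars_const : (const c hc : F.Term V).vars = ∅ := by
  rw [const, vars_app, Set.iUnion_eq_empty]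
  exact fun i => (i.cast hc).elim0

@[simp] theorem vars_bin (s t : F.Term V) : (bin p hp s t).vars = s.vars ∪ t.vars := by
  ext x
  rw [bin, vars_app, Set.mem_iUnion]
  exact (finCongr hp).exists_congr_left.trans Fin.exists_fin_two

@[simp] theorem isOver_const {S : Set (Fin F.size)} :
    (const c hc : F.Term V).IsOver S ↔ c ∈ S := by
  rw [const, isOver_app]
  exact and_iff_left fun i => (i.cast hc).elim0

@[simp] theorem isOver_bin {S : Set (Fin F.size)} {s t : F.Term V} :
    (bin p hp s t).IsOver S ↔ p ∈ S ∧ s.IsOver S ∧ t.IsOver S := by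
  rw [bin, isOver_app, forall_arg_bin hp (P := IsOver S)]

theorem one_le_height_bin (s t : F.Term V) : 1 ≤ (bin p hp s t).height := by
  rw [bin, height_app]
  exact (Nat.le_add_left 1 _).trans (Finset.le_sup (f := fun i => (![s, t] (i.cast hp)).height + 1)
    (Finset.mem_univ (Fin.cast hp.symm 0)))

theorem height_bin_le_one {s t : F.Term V} (hs : s.height = 0) (ht : t.height = 0) :
    (bin p hp s t).height ≤ 1 := by
  rw [bin, height_app]
  refine Finset.sup_le fun i _ => Nat.succ_le_succ ?_
  exact (forall_arg_bin hp (P := fun u => u.height ≤ 0)).2 ⟨hs.le, ht.le⟩ i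

theorem code_const : (const c hc : F.Term ℕ).code = [Sum.inr (c : ℕ)] := by
  rw [const, code_app, List.ofFn_congr hc]
  simp

theorem code_bin (s t : F.Term ℕ) :
    (bin p hp s t).code = Sum.inr (p : ℕ) :: (s.code ++ t.code) := by
  rw [bin, code_app, List.ofFn_congr hp]
  simp

end ConstBin

end Term

/-- A rewrite step at the root by a rule in `P`. -/
def RootStep (P : Set F.Rule) (t u : F.Term V) : Prop :=
  ∃ ρ ∈ P, ∃ σ : ℕ → F.Term V, ρ.1.subst σ = t ∧ ρ.2.subst σ = u

section Steps

variable {R : F.TRS}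

theorem RootStep.step {t u : F.Term V} (h : RootStep R.rules t u) : R.Step t u := by
  obtain ⟨ρ, hρ, σ, rfl, rfl⟩ := h
  exact .root ρ hρ σ

theorem TRS.step_app {f : Fin F.size} {ts : Fin (F.rank f) → F.Term V} {u : F.Term V}
    (h : R.Step (.app f ts) u) :
    RootStep R.rules (.app f ts) u ∨
      ∃ i s, R.Step (ts i) s ∧ u = .app f (Function.update ts i s) := by
  generalize ht : Term.app f ts = t at h
  cases h with
  | root ρ hρ σ => exact .inl ⟨ρ, hρ, σ, rfl, rfl⟩
  | arg g us i s hs => cases ht; exact .inr ⟨i, s, hs, rfl⟩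

theorem TRS.step_bin {p : Fin F.size} {hp : F.rank p = 2} {s t u : F.Term V}
    (h : R.Step (.bin p hp s t) u) :
    RootStep R.rules (.bin p hp s t) u ∨
      (∃ s', R.Step s s' ∧ u = .bin p hp s' t) ∨ ∃ t', R.Step t t' ∧ u = .bin p hp s t' := by
  refine (TRS.step_app h).imp_right ?_
  rintro ⟨i, v, hv, rfl⟩
  rw [Term.app_eq_bin hp]
  obtain ⟨j, rfl⟩ : ∃ j, i = Fin.cast hp.symm j := ⟨i.cast hp, rfl⟩
  fin_cases j
  · exact .inl ⟨v, hv, by simp [Function.update]⟩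
  · exact .inr ⟨v, hv, by simp [Function.update]⟩

theorem TRS.reach_app {f : Fin F.size} {ts us : Fin (F.rank f) → F.Term V}
    (h : ∀ i, ReflTransGen R.Step (ts i) (us i)) :
    ReflTransGen R.Step (.app f ts) (.app f us) := by
  suffices ∀ s : Finset (Fin (F.rank f)),
      ReflTransGen R.Step (.app f ts) (.app f (s.piecewise us ts)) by
    simpa using this Finset.univ
  intro s
  induction s using Finset.induction_on with
  | empty => simpa using ReflTransGen.refl
  | insert i s hi ih =>
    rw [Finset.piecewise_insert]
    have hw : Function.update (s.piecewise us ts) i (ts i) = s.piecewise us ts := by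
      rw [← Finset.piecewise_eq_of_notMem s us ts hi, Function.update_eq_self]
    refine ih.trans ?_
    nth_rw 1 [← hw]
    refine (h i).lift (fun x => Term.app f (Function.update (s.piecewise us ts) i x))
      fun x y hxy => ?_
    have := TRS.Step.arg f (Function.update (s.piecewise us ts) i x) i y (by simpa using hxy)
    rwa [Function.update_idem] at this

theorem TRS.reach_bin {p : Fin F.size} {hp : F.rank p = 2} {s t s' t' : F.Term V}
    (hs : ReflTransGen R.Step s s') (ht : ReflTransGen R.Step t t') :
    ReflTransGen R.Step (.bin p hp s t) (.bin p hp s' t') :=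
  TRS.reach_app fun i =>
    (Fin.forall_fin_two (p := fun j => ReflTransGen R.Step (![s, t] j) (![s', t'] j))).2 ⟨hs, ht⟩
      (i.cast hp)

theorem TRS.reach_of_forall_step_app {S : Set (Fin F.size)} {g : F.GroundTerm}
    (hg : ∀ f ∈ S, R.Step g (.app f fun _ => g)) {t : F.GroundTerm} (ht : t.IsOver S) :
    ReflTransGen R.Step g t := by
  induction t with
  | var x => exact x.elim
  | app f ts ih =>
    rw [Term.isOver_app] at ht
    exact .head (hg f ht.1) (TRS.reach_app fun i => ih i (ht.2 i))

theorem TRS.Step.isOver {S : Set (Fin F.size)}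
    (hR : ∀ ρ ∈ R.rules, ρ.1.IsOver S → ρ.2.IsOver S) {t u : F.Term V}
    (htu : R.Step t u) (ht : t.IsOver S) : u.IsOver S := by
  induction htu with
  | root ρ hρ σ =>
    rw [Term.isOver_subst] at ht ⊢
    exact ⟨hR ρ hρ ht.1, fun x hx => ht.2 x (R.vars_subset ρ hρ hx)⟩
  | arg f ts i _ _ ih =>
    rw [Term.isOver_app] at ht ⊢
    refine ⟨ht.1, fun j => ?_⟩
    rcases eq_or_ne j i with rfl | hj
    · simpa only [Function.update_self] using ih (ht.2 j)
    · simpa only [Function.update_of_ne hj] using ht.2 j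

theorem TRS.isOver_of_reach {S : Set (Fin F.size)}
    (hR : ∀ ρ ∈ R.rules, ρ.1.IsOver S → ρ.2.IsOver S) {t u : F.Term V}
    (htu : ReflTransGen R.Step t u) (ht : t.IsOver S) : u.IsOver S := by
  induction htu with
  | refl => exact ht
  | tail _ h ih => exact h.isOver hR ih

theorem TRS.not_step_of_isOver {S : Set (Fin F.size)} (hR : ∀ ρ ∈ R.rules, ¬ ρ.1.IsOver S)
    {t u : F.Term V} (ht : t.IsOver S) : ¬ R.Step t u := by
  intro h
  induction h with
  | root ρ hρ σ => exact hR ρ hρ (Term.isOver_subst.1 ht).1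
  | arg f ts i _ _ ih => exact ih ((Term.isOver_app.1 ht).2 i)

end Steps

/-- The rewrite system whose rules are listed in `rs`. -/
def TRS.ofList (rs : List F.Rule) (hrs : ∀ ρ ∈ rs, ρ.2.vars ⊆ ρ.1.vars) : F.TRS where
  rules := {ρ | ρ ∈ rs}
  finite := rs.finite_toSet
  vars_subset := hrs

section Recognizability

theorem BTA.reaches_app_mono {A : Type} {B : F.BTA A} {f : Fin F.size}
    {ts us : Fin (F.rank f) → F.GroundTerm} (h : ∀ i a, B.Reaches (ts i) a → B.Reaches (us i) a)
    {a : A} (ha : B.Reaches (.app f ts) a) : B.Reaches (.app f us) a := by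
  generalize ht : Term.app f ts = t at ha
  induction ha with
  | trans g vs q a hq htr _ => cases ht; exact .trans f us q a (fun i => h i _ (hq i)) htr
  | eps t a b _ hab ih => exact .eps _ a b (ih ht) hab

-- A form of the Myhill–Nerode theorem: `φ` is the projection modulo a congruence of finite index.
theorem recognizable_iff {L : Set F.GroundTerm} :
    Recognizable L ↔ ∃ (A : Type) (_ : Finite A) (φ : F.GroundTerm → A),
      (∀ f ts us, (∀ i, φ (ts i) = φ (us i)) → φ (.app f ts) = φ (.app f us)) ∧
        ∀ t u, φ t = φ u → t ∈ L → u ∈ L := by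
  constructor
  · rintro ⟨A, _, B, rfl⟩
    refine ⟨Set A, inferInstance, fun t => {a | B.Reaches t a}, fun f ts us h => ?_, ?_⟩
    · exact Set.Subset.antisymm (fun _ => BTA.reaches_app_mono fun i => (h i).subset)
        fun _ => BTA.reaches_app_mono fun i => (h i).superset
    · rintro t u h ⟨a, ha, hta⟩
      exact ⟨a, ha, h.subset hta⟩
  · rintro ⟨A, hA, φ, hφ, hL⟩
    let B : F.BTA A :=
      ⟨fun f q a => ∃ ts, (∀ i, φ (ts i) = q i) ∧ φ (.app f ts) = a, fun _ _ => False, φ '' L⟩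
    have reaches_iff (t : F.GroundTerm) (a : A) : B.Reaches t a ↔ φ t = a := by
      constructor
      · intro h
        induction h with
        | trans f ts q a _ htr ih =>
          obtain ⟨us, hus, rfl⟩ := htr
          exact hφ f ts us fun i => (ih i).trans (hus i).symm
        | eps _ _ _ _ h => exact h.elim
      · rintro rfl
        induction t with
        | var x => exact x.elim
        | app f ts ih => exact .trans f ts _ _ ih ⟨ts, fun _ => rfl, rfl⟩
    refine ⟨A, hA, B, Set.ext fun t => ⟨?_, fun ht => ?_⟩⟩
    · rintro ⟨_, ⟨u, hu, rfl⟩, htu⟩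
      exact hL u t ((reaches_iff t _).1 htu).symm hu
    · exact ⟨_, ⟨t, ht, rfl⟩, (reaches_iff t _).2 rfl⟩

theorem recognizable_univ : Recognizable (Set.univ : Set F.GroundTerm) :=
  recognizable_iff.2 ⟨Unit, inferInstance, fun _ => (), fun _ _ _ _ => rfl, fun _ _ _ => id⟩

variable {R : F.TRS} {U : Set F.GroundTerm}

theorem TRS.exists_reach_args
    (harg : ∀ f ts, Term.app f ts ∈ U → ∀ i, ts i ∈ U)
    (hroot : ∀ t ∈ R.descendants U, ∀ f ts, RootStep R.rules t (.app f ts) → ∀ i, ts i ∈ U)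
    {u t : F.GroundTerm} (hu : u ∈ U) (hut : ReflTransGen R.Step u t) {f : Fin F.size}
    {ts : Fin (F.rank f) → F.GroundTerm} (ht : t = .app f ts) :
    ∃ us, (∀ i, us i ∈ U) ∧ (∀ i, ReflTransGen R.Step (us i) (ts i)) ∧
      ReflTransGen R.Step u (.app f us) := by
  induction hut generalizing f ts with
  | refl => subst ht; exact ⟨ts, harg f ts hu, fun _ => .refl, .refl⟩
  | @tail s t hus hst ih =>
    subst ht
    cases s with
    | var x => exact x.elim
    | app g vs =>
    rcases TRS.step_app hst with h | ⟨i, s, hs, e⟩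
    · exact ⟨ts, hroot _ ⟨u, hu, hus⟩ f ts h, fun _ => .refl, hus.tail h.step⟩
    · cases e
      obtain ⟨us, hU, hreach, h⟩ := ih rfl
      refine ⟨us, hU, fun j => ?_, h⟩
      rcases eq_or_ne j i with rfl | hj
      · simpa only [Function.update_self] using (hreach j).tail hs
      · simpa only [Function.update_of_ne hj] using hreach j

theorem TRS.recognizable_descendants (hU : U.Finite)
    (harg : ∀ f ts, Term.app f ts ∈ U → ∀ i, ts i ∈ U)
    (hroot : ∀ t ∈ R.descendants U, ∀ f ts, RootStep R.rules t (.app f ts) → ∀ i, ts i ∈ U)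
    {L : Set F.GroundTerm} (hL : L ⊆ U) : Recognizable (R.descendants L) := by
  have : Finite U := hU
  refine recognizable_iff.2
    ⟨U → Prop, inferInstance, fun t u => ReflTransGen R.Step u.1 t, fun f ts ts' h => ?_, ?_⟩
  · have reach_congr {ts ts' : Fin (F.rank f) → F.GroundTerm}
        (h : ∀ i, ∀ u : U, ReflTransGen R.Step u.1 (ts i) → ReflTransGen R.Step u.1 (ts' i))
        (u : U) (hut : ReflTransGen R.Step u.1 (.app f ts)) :
        ReflTransGen R.Step u.1 (.app f ts') := by
      obtain ⟨us, hus, hreach, hu⟩ := TRS.exists_reach_args harg hroot u.2 hut rfl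
      exact hu.trans (TRS.reach_app fun i => h i ⟨us i, hus i⟩ (hreach i))
    exact funext fun u => propext
      ⟨reach_congr (fun i v => (congrFun (h i) v).mp) u,
        reach_congr (fun i v => (congrFun (h i) v).mpr) u⟩
  · rintro t t' h ⟨u, hu, hut⟩
    exact ⟨u, hu, (congrFun h ⟨u, hL hu⟩).mp hut⟩

end Recognizability

/-- The alphabet of the reduction. Its symbols are, in this order, the constants `leaf`, `genL`,
`genR` and `flood`, and the binary symbols `node`, `start` and `check`. -/
abbrev verifier : RankedAlphabet := ⟨7, ![0, 0, 0, 0, 2, 2, 2]⟩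

namespace verifier

abbrev leaf : verifier.Term V := .const 0 (by decide)
abbrev genL : verifier.Term V := .const 1 (by decide)
abbrev genR : verifier.Term V := .const 2 (by decide)
abbrev flood : verifier.Term V := .const 3 (by decide)
abbrev node (s t : verifier.Term V) : verifier.Term V := .bin 4 (by decide) s t
abbrev start (s t : verifier.Term V) : verifier.Term V := .bin 5 (by decide) s t
abbrev check (s t : verifier.Term V) : verifier.Term V := .bin 6 (by decide) s t

theorem app_cases (f : Fin verifier.size) (ts : Fin (verifier.rank f) → verifier.Term V) :
    (Term.app f ts = leaf ∨ Term.app f ts = genL ∨ Term.app f ts = genR ∨ Term.app f ts = flood) ∨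
      ∃ i j, Term.app f ts = node (ts i) (ts j) ∨ Term.app f ts = start (ts i) (ts j) ∨
        Term.app f ts = check (ts i) (ts j) := by
  have hc (hf : verifier.rank f = 0) := Term.app_eq_const hf ts
  have hb (hf : verifier.rank f = 2) := Term.app_eq_bin hf ts
  fin_cases f
  · exact .inl (.inl (hc rfl))
  · exact .inl (.inr (.inl (hc rfl)))
  · exact .inl (.inr (.inr (.inl (hc rfl))))
  · exact .inl (.inr (.inr (.inr (hc rfl))))
  · exact .inr ⟨_, _, .inl (hb rfl)⟩
  · exact .inr ⟨_, _, .inr (.inl (hb rfl))⟩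
  · exact .inr ⟨_, _, .inr (.inr (hb rfl))⟩

/-- The terms over `leaf` and `node`, which serve as configurations and as histories. -/
abbrev IsPlain (t : verifier.Term V) : Prop := t.IsOver {0, 4}

section System

variable (ms : List verifier.Rule) (c₀ : verifier.GroundTerm) (h : verifier.Term ℕ)

/-- Renames the variables of a term so that `x₀, …, x_{k-1}` become fresh. -/
def shift (k : ℕ) (t : verifier.Term ℕ) : verifier.Term ℕ :=
  t.subst fun x => .var (x + k)

theorem subst_shift (σ : ℕ → verifier.Term V) (k : ℕ) (t : verifier.Term ℕ) :
    (shift k t).subst σ = t.subst fun x => σ (x + k) :=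
  Term.subst_subst _ _ t

/-- The rule that checks that the first entry of a history is rewritten to the second one by `ρ`
and passes to the rest of the history. Reading this rest off the second argument of `check`, which
is a copy of the first one, keeps the right-hand side flat. -/
def historyRule (ρ : verifier.Rule) : verifier.Rule :=
  (check (node (shift 3 ρ.1) (node (shift 3 ρ.2) (.var 0))) (node (.var 1) (.var 2)),
    check (.var 2) (.var 2))

/-- The rules that rewrite the constant `g` to `f(g, …, g)` for the symbols `f` in `fs`. -/
def generatorRules (g : verifier.Term ℕ) (fs : List (Fin verifier.size)) : List verifier.Rule :=
  fs.map fun f => (g, .app f fun _ => g)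

/-- The guess of a history starting with `c₀` in two copies. -/
def restart : verifier.GroundTerm :=
  start (node c₀ genL) (node c₀ genR)

/-- The monadic part of `system`. -/
def monadicRules : List verifier.Rule :=
  (start (.var 0) (.var 0), check (.var 0) (.var 0)) :: ms.map historyRule

/-- The right-ground part of `system`. -/
def rightGroundRules : List verifier.Rule :=
  (start (.var 0) (.var 1), .ofGround (restart c₀)) ::
  (check (.var 0) (.var 1), .ofGround (restart c₀)) ::
  (check (node (shift 2 h) (.var 0)) (.var 1), flood) ::
  (node flood (.var 0), flood) ::
  (node (.var 0) flood, flood) ::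
    (generatorRules genL [0, 4] ++ generatorRules genR [0, 4] ++
      generatorRules flood (List.finRange _))

theorem vars_subset_of_mem_monadicRules {ρ : verifier.Rule} (hρ : ρ ∈ monadicRules ms) :
    ρ.2.vars ⊆ ρ.1.vars := by
  rcases List.mem_cons.1 hρ with rfl | hρ
  · simp
  · obtain ⟨ρ, -, rfl⟩ := List.mem_map.1 hρ
    simp [historyRule]

theorem vars_of_mem_generatorRules {c : Fin verifier.size} {hc : verifier.rank c = 0}
    {fs : List (Fin verifier.size)} {ρ : verifier.Rule} (hρ : ρ ∈ generatorRules (.const c hc) fs) :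
    ρ.2.vars = ∅ := by
  obtain ⟨f, -, rfl⟩ := List.mem_map.1 hρ
  simp [Term.vars_app]

theorem vars_of_mem_rightGroundRules {ρ : verifier.Rule} (hρ : ρ ∈ rightGroundRules c₀ h) :
    ρ.2.vars = ∅ := by
  simp only [rightGroundRules, List.mem_cons, List.mem_append] at hρ
  rcases hρ with rfl | rfl | rfl | rfl | rfl | (hρ | hρ) | hρ
  all_goals first | exact vars_of_mem_generatorRules hρ | simp

theorem vars_subset_of_mem_rightGroundRules {ρ : verifier.Rule} (hρ : ρ ∈ rightGroundRules c₀ h) :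
    ρ.2.vars ⊆ ρ.1.vars :=
  (vars_of_mem_rightGroundRules c₀ h hρ).trans_subset (Set.empty_subset _)

/-- The rules of `system`, in the order of the instance given to an algorithm. -/
def systemRules : List verifier.Rule :=
  monadicRules ms ++ rightGroundRules c₀ h

/-- The system that guesses a history starting with `c₀` in two copies, verifies that each of its
steps uses a rule in `ms`, and produces `flood`, which rewrites to all ground terms, when it
encounters an instance of `h`. -/
def system : verifier.TRS :=
  .ofList (systemRules ms c₀ h) fun _ hρ => (List.mem_append.1 hρ).elim
    (vars_subset_of_mem_monadicRules ms) (vars_subset_of_mem_rightGroundRules c₀ h)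

theorem isMurg_system : (system ms c₀ h).IsMurg := by
  refine ⟨.ofList (monadicRules ms) fun _ => vars_subset_of_mem_monadicRules ms,
    .ofList (rightGroundRules c₀ h) fun _ => vars_subset_of_mem_rightGroundRules c₀ h,
    fun _ hρ => ?_, fun _ => vars_of_mem_rightGroundRules c₀ h, Set.ext fun _ => List.mem_append⟩
  rcases List.mem_cons.1 hρ with rfl | hρ
  · exact ⟨Term.one_le_height_bin _ _, Term.height_bin_le_one rfl rfl⟩
  · obtain ⟨ρ, -, rfl⟩ := List.mem_map.1 hρ
    exact ⟨Term.one_le_height_bin _ _, Term.height_bin_le_one rfl rfl⟩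

end System

section Steps

variable {ms : List verifier.Rule} {c₀ : verifier.GroundTerm} {h : verifier.Term ℕ}

theorem mem_generatorRules_of_isOver {ρ : verifier.Rule} (hρ : ρ ∈ systemRules ms c₀ h)
    (hl : ρ.1.IsOver {0, 1, 2, 4}) :
    ρ ∈ generatorRules genL [0, 4] ++ generatorRules genR [0, 4] := by
  simp only [systemRules, monadicRules, rightGroundRules, List.mem_cons, List.mem_append,
    List.mem_map] at hρ
  rcases hρ with (rfl | ⟨ρ, -, rfl⟩) | rfl | rfl | rfl | rfl | rfl | hρ | hρ
  case inr.inr.inr.inr.inr.inr.inl => exact List.mem_append.2 hρ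
  case inr.inr.inr.inr.inr.inr.inr =>
    obtain ⟨f, -, rfl⟩ := List.mem_map.1 hρ
    simp at hl
  all_goals simp [historyRule] at hl

theorem left_eq_of_isOver {ρ : verifier.Rule} (hρ : ρ ∈ systemRules ms c₀ h)
    (hl : ρ.1.IsOver {0, 1, 2, 4}) : ρ.1 = genL ∨ ρ.1 = genR := by
  rcases List.mem_append.1 (mem_generatorRules_of_isOver hρ hl) with hρ | hρ <;>
    obtain ⟨f, -, rfl⟩ := List.mem_map.1 hρ <;> simp

theorem isOver_right {S : Set (Fin verifier.size)} (hS : {0, 4} ⊆ S)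
    (hS' : S ⊆ {0, 1, 2, 4}) {ρ : verifier.Rule} (hρ : ρ ∈ systemRules ms c₀ h)
    (hl : ρ.1.IsOver S) : ρ.2.IsOver S := by
  rcases List.mem_append.1 (mem_generatorRules_of_isOver hρ (hl.mono hS')) with hρ | hρ <;>
  · obtain ⟨f, hf, rfl⟩ := List.mem_map.1 hρ
    exact Term.isOver_app.2 ⟨hS (by simpa using hf), fun _ => hl⟩

theorem not_step_of_isPlain {t u : verifier.Term V} (ht : IsPlain t) :
    ¬ (system ms c₀ h).Step t u := by
  refine TRS.not_step_of_isOver (fun ρ hρ hl => ?_) ht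
  rcases left_eq_of_isOver hρ (hl.mono (by grind)) with e | e <;> simp [e] at hl

theorem rootStep_start {s t u : verifier.GroundTerm}
    (hu : RootStep (system ms c₀ h).rules (start s t) u) :
    s = t ∧ u = check s s ∨ u = restart c₀ := by
  obtain ⟨ρ, hρ, σ, e, rfl⟩ := hu
  simp only [system, TRS.ofList, systemRules, monadicRules, rightGroundRules, generatorRules,
    List.mem_cons, List.mem_append, List.mem_map, Set.mem_ofPred_eq] at hρ
  rcases hρ with (rfl | ⟨ρ, -, rfl⟩) | rfl | rfl | rfl | rfl | rfl |
    (⟨f, -, rfl⟩ | ⟨f, -, rfl⟩) | ⟨f, -, rfl⟩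
  case inl.inl =>
    obtain ⟨rfl, rfl⟩ : σ 0 = s ∧ σ 0 = t := by simpa using e
    exact .inl ⟨rfl, Term.subst_bin _ _ _⟩
  case inr.inl => simp
  all_goals simp [historyRule] at e

theorem rootStep_check {s t u : verifier.GroundTerm}
    (hu : RootStep (system ms c₀ h).rules (check s t) u) :
    (∃ ρ ∈ ms, ∃ (σ : ℕ → verifier.GroundTerm) (x y z : verifier.GroundTerm),
      s = node (ρ.1.subst σ) (node (ρ.2.subst σ) x) ∧ t = node y z ∧ u = check z z) ∨
    u = restart c₀ ∨ ∃ (σ : ℕ → verifier.GroundTerm) (x : verifier.GroundTerm),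
      s = node (h.subst σ) x := by
  obtain ⟨ρ, hρ, σ, e, rfl⟩ := hu
  simp only [system, TRS.ofList, systemRules, monadicRules, rightGroundRules, generatorRules,
    List.mem_cons, List.mem_append, List.mem_map, Set.mem_ofPred_eq] at hρ
  rcases hρ with (rfl | ⟨ρ, hρ, rfl⟩) | rfl | rfl | rfl | rfl | rfl |
    (⟨f, -, rfl⟩ | ⟨f, -, rfl⟩) | ⟨f, -, rfl⟩
  case inl.inr =>
    simp only [historyRule, Term.subst_bin, Term.bin_inj, true_and, subst_shift] at e
    exact .inl ⟨ρ, hρ, _, _, _, _, e.1.symm, e.2.symm, Term.subst_bin _ _ _⟩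
  case inr.inr.inl => simp
  case inr.inr.inr.inl =>
    simp only [Term.subst_bin, Term.bin_inj, true_and, subst_shift] at e
    exact .inr (.inr ⟨_, _, e.1.symm⟩)
  all_goals simp at e

theorem step_of_mem {l r : verifier.Term ℕ} (hlr : (l, r) ∈ systemRules ms c₀ h)
    (σ : ℕ → verifier.GroundTerm) {t u : verifier.GroundTerm} (ht : l.subst σ = t)
    (hu : r.subst σ = u) : (system ms c₀ h).Step t u := by
  subst ht hu
  exact .root (l, r) hlr σ

theorem step_start_check (t : verifier.GroundTerm) :
    (system ms c₀ h).Step (start t t) (check t t) :=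
  step_of_mem (l := start (.var 0) (.var 0)) (r := check (.var 0) (.var 0))
    (by simp [systemRules, monadicRules]) (fun _ => t) (by simp) (by simp)

theorem step_check_check {t u : verifier.GroundTerm} (htu : RootStep {ρ | ρ ∈ ms} t u)
    (w : verifier.GroundTerm) : (system ms c₀ h).Step
      (check (node t (node u w)) (node t (node u w))) (check (node u w) (node u w)) := by
  obtain ⟨ρ, hρ, σ, rfl, rfl⟩ := htu
  exact step_of_mem (l := (historyRule ρ).1) (r := (historyRule ρ).2)
    (List.mem_append_left _ (List.mem_cons_of_mem _ (List.mem_map_of_mem hρ)))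
    (fun | 0 => w | 1 => ρ.1.subst σ | 2 => node (ρ.2.subst σ) w | x + 3 => σ x)
    (by simp [historyRule, subst_shift]) (by simp [historyRule])

theorem step_start_restart (s t : verifier.GroundTerm) :
    (system ms c₀ h).Step (start s t) (restart c₀) :=
  step_of_mem (l := start (.var 0) (.var 1)) (r := .ofGround (restart c₀))
    (by simp [systemRules, rightGroundRules]) (fun | 0 => s | _ => t) (by simp) (by simp)

theorem step_check_restart (s t : verifier.GroundTerm) :
    (system ms c₀ h).Step (check s t) (restart c₀) :=
  step_of_mem (l := check (.var 0) (.var 1)) (r := .ofGround (restart c₀))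
    (by simp [systemRules, rightGroundRules]) (fun | 0 => s | _ => t) (by simp) (by simp)

theorem step_check_flood (σ : ℕ → verifier.GroundTerm) (s t : verifier.GroundTerm) :
    (system ms c₀ h).Step (check (node (h.subst σ) s) t) flood :=
  step_of_mem (l := check (node (shift 2 h) (.var 0)) (.var 1)) (r := flood)
    (by simp [systemRules, rightGroundRules]) (fun | 0 => s | 1 => t | x + 2 => σ x)
    (by simp [subst_shift]) (by simp)

theorem step_node_flood_left (t : verifier.GroundTerm) :
    (system ms c₀ h).Step (node flood t) flood :=
  step_of_mem (l := node flood (.var 0)) (r := flood)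
    (by simp [systemRules, rightGroundRules]) (fun _ => t) (by simp) (by simp)

theorem step_node_flood_right (t : verifier.GroundTerm) :
    (system ms c₀ h).Step (node t flood) flood :=
  step_of_mem (l := node (.var 0) flood) (r := flood)
    (by simp [systemRules, rightGroundRules]) (fun _ => t) (by simp) (by simp)

theorem step_of_generatorRules_subset {c : Fin verifier.size} {hc : verifier.rank c = 0}
    {fs : List (Fin verifier.size)}
    (hfs : generatorRules (.const c hc) fs ⊆ systemRules ms c₀ h) {f : Fin verifier.size}
    (hf : f ∈ fs) : (system ms c₀ h).Step (.const c hc : verifier.GroundTerm)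
      (.app f fun _ => .const c hc) :=
  step_of_mem (hfs (List.mem_map_of_mem hf)) (fun _ => leaf) (by simp) (by simp [Term.subst_app])

theorem genL_reach {t : verifier.GroundTerm} (ht : IsPlain t) :
    ReflTransGen (system ms c₀ h).Step genL t :=
  TRS.reach_of_forall_step_app (fun _ hf => step_of_generatorRules_subset (fs := [0, 4])
    (fun _ hρ => by simp [systemRules, rightGroundRules, hρ]) (by simpa using hf)) ht

theorem genR_reach {t : verifier.GroundTerm} (ht : IsPlain t) :
    ReflTransGen (system ms c₀ h).Step genR t :=
  TRS.reach_of_forall_step_app (fun _ hf => step_of_generatorRules_subset (fs := [0, 4])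
    (fun _ hρ => by simp [systemRules, rightGroundRules, hρ]) (by simpa using hf)) ht

theorem flood_reach (t : verifier.GroundTerm) : ReflTransGen (system ms c₀ h).Step flood t :=
  TRS.reach_of_forall_step_app (fun f _ => step_of_generatorRules_subset (fs := List.finRange _)
    (fun _ hρ => by simp [systemRules, rightGroundRules, hρ]) (List.mem_finRange f)) t.isOver_univ

end Steps

/-- A rewrite step by `ms` at the root that produces a plain term. -/
def PlainStep (ms : List verifier.Rule) (t u : verifier.GroundTerm) : Prop :=
  IsPlain u ∧ RootStep {ρ | ρ ∈ ms} t u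

/-- Plain root steps by `ms` lead from `c₀` to an instance of `h`. -/
def Accepts (ms : List verifier.Rule) (c₀ : verifier.GroundTerm) (h : verifier.Term ℕ) : Prop :=
  ∃ σ, ReflTransGen (PlainStep ms) c₀ (h.subst σ)

section Recognizability

variable {ms : List verifier.Rule} {c₀ : verifier.GroundTerm} {h : verifier.Term ℕ}

theorem exists_history {t u : verifier.GroundTerm} (htu : ReflTransGen (PlainStep ms) t u) :
    ∃ w, IsPlain w ∧ ReflTransGen (system ms c₀ h).Step
      (check (node t w) (node t w)) (check (node u leaf) (node u leaf)) := by
  induction htu using ReflTransGen.head_induction_on with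
  | refl => exact ⟨leaf, by simp, .refl⟩
  | @head t t' h _ ih =>
    obtain ⟨w, hw, hreach⟩ := ih
    exact ⟨node t' w, by simp [h.1, hw], .head (step_check_check h.2 w) hreach⟩

theorem restart_reach_check {t : verifier.GroundTerm} (ht : IsPlain t) :
    ReflTransGen (system ms c₀ h).Step (restart c₀) (check (node c₀ t) (node c₀ t)) :=
  .tail (TRS.reach_bin (TRS.reach_bin .refl (genL_reach ht)) (TRS.reach_bin .refl (genR_reach ht)))
    (step_start_check _)

theorem restart_reach_flood (H : Accepts ms c₀ h) :
    ReflTransGen (system ms c₀ h).Step (restart c₀) flood := by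
  obtain ⟨σ, hσ⟩ := H
  obtain ⟨w, hw, hreach⟩ := exists_history hσ
  exact ((restart_reach_check hw).trans hreach).tail (step_check_flood σ _ _)

theorem isOver_or_reach_flood (H : Accepts ms c₀ h) (t : verifier.GroundTerm) :
    t.IsOver {0, 1, 2, 4} ∨ ReflTransGen (system ms c₀ h).Step t flood := by
  induction t with
  | var x => exact x.elim
  | app f ts ih =>
    rcases app_cases f ts with (e | e | e | e) | ⟨i, j, e | e | e⟩ <;> rw [e]
    · simp
    · simp
    · simp
    · exact .inr .refl
    · rcases ih i with hi | hi
      · rcases ih j with hj | hj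
        · simp [hi, hj]
        · exact .inr ((TRS.reach_bin .refl hj).tail (step_node_flood_right _))
      · exact .inr ((TRS.reach_bin hi .refl).tail (step_node_flood_left _))
    · exact .inr (.head (step_start_restart _ _) (restart_reach_flood H))
    · exact .inr (.head (step_check_restart _ _) (restart_reach_flood H))

theorem recognizable_descendants_of_isOver {L : Set verifier.GroundTerm} (hL : L.Finite)
    (hLt : ∀ t ∈ L, t.IsOver {0, 1, 2, 4}) : Recognizable ((system ms c₀ h).descendants L) := by
  let U : Set verifier.GroundTerm := (⋃ t ∈ L, t.subterms) ∪ {genL, genR}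
  have hU : ∀ u ∈ U, u.IsOver {0, 1, 2, 4} := by
    rintro u (hu | rfl | rfl)
    · obtain ⟨t, ht, hu⟩ := Set.mem_iUnion₂.1 hu
      exact (hLt t ht).of_mem_subterms hu
    · simp
    · simp
  refine TRS.recognizable_descendants (U := U)
    ((hL.biUnion fun t _ => t.finite_subterms).union (Set.toFinite _)) ?_ ?_
    fun t ht => .inl (Set.mem_biUnion ht t.mem_subterms_self)
  · rintro f ts (hu | hu | hu) i
    · obtain ⟨t, ht, hu⟩ := Set.mem_iUnion₂.1 hu
      exact .inl (Set.mem_biUnion ht (Term.arg_mem_subterms hu i))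
    · obtain rfl := (Term.app.inj hu).1
      exact i.elim0
    · obtain rfl := (Term.app.inj hu).1
      exact i.elim0
  · rintro t ⟨u, hu, hut⟩ f ts ⟨ρ, hρ, σ, rfl, e⟩ i
    have ht := TRS.isOver_of_reach (fun ρ => isOver_right (by simp) subset_rfl)
      hut (hU u hu)
    rcases List.mem_append.1 (mem_generatorRules_of_isOver hρ (Term.isOver_subst.1 ht).1)
      with hρ | hρ <;> obtain ⟨g, -, rfl⟩ := List.mem_map.1 hρ
    · rw [Term.subst_app] at e
      cases e
      simp [U]
    · rw [Term.subst_app] at e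
      cases e
      simp [U]

theorem preserves_of_accepts (H : Accepts ms c₀ h) :
    (system ms c₀ h).PreservesFiniteRecognizability := by
  intro L hL
  by_cases hf : ∃ t ∈ L, ReflTransGen (system ms c₀ h).Step t flood
  · obtain ⟨t, ht, hf⟩ := hf
    rw [show (system ms c₀ h).descendants L = Set.univ from
      Set.eq_univ_of_forall fun u => ⟨t, ht, hf.trans (flood_reach u)⟩]
    exact recognizable_univ
  · exact recognizable_descendants_of_isOver hL fun t ht =>
      (isOver_or_reach_flood H t).resolve_right fun hr => hf ⟨t, ht, hr⟩

end Recognizability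

section Nonrecognizability

variable {ms : List verifier.Rule} {c₀ : verifier.GroundTerm} {h : verifier.Term ℕ}

/-- The shape of the descendants of `restart c₀` when no instance of the final pattern is
encountered: two histories in the making, or two equal histories whose verification has arrived
at `c`. -/
def IsGenuine (ms : List verifier.Rule) (c₀ t : verifier.GroundTerm) : Prop :=
  (∃ r s, t = start (node c₀ r) (node c₀ s) ∧ r.IsOver {0, 1, 4} ∧ s.IsOver {0, 2, 4}) ∨
    ∃ c w, t = check (node c w) (node c w) ∧ IsPlain (node c w) ∧ ReflTransGen (PlainStep ms) c₀ c

theorem isGenuine_restart : IsGenuine ms c₀ (restart c₀) :=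
  .inl ⟨_, _, rfl, by simp, by simp⟩

theorem IsGenuine.of_step_start (hc₀ : IsPlain c₀) {r s u : verifier.GroundTerm}
    (hr : r.IsOver {0, 1, 4}) (hs : s.IsOver {0, 2, 4})
    (hu : (system ms c₀ h).Step (start (node c₀ r) (node c₀ s)) u) : IsGenuine ms c₀ u := by
  have step_node {S : Set (Fin verifier.size)} (hS : {0, 4} ⊆ S) (hS' : S ⊆ {0, 1, 2, 4})
      {t v : verifier.GroundTerm} (ht : t.IsOver S) (hv : (system ms c₀ h).Step (node c₀ t) v) :
      ∃ t', v = node c₀ t' ∧ t'.IsOver S := by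
    rcases TRS.step_bin hv with ⟨ρ, hρ, σ, e, -⟩ | ⟨_, hc, -⟩ | ⟨t', ht', rfl⟩
    · have hl : (ρ.1.subst σ).IsOver {0, 1, 2, 4} := by
        simp [e, hc₀.mono (hS.trans hS'), ht.mono hS']
      rcases left_eq_of_isOver hρ (Term.isOver_subst.1 hl).1 with hl | hl <;> simp [hl] at e
    · exact absurd hc (not_step_of_isPlain hc₀)
    · exact ⟨t', rfl, ht'.isOver (fun _ => isOver_right hS hS') ht⟩
  rcases TRS.step_bin hu with hroot | ⟨v, hv, rfl⟩ | ⟨v, hv, rfl⟩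
  · rcases rootStep_start hroot with ⟨e, rfl⟩ | rfl
    · obtain ⟨-, rfl⟩ : True ∧ r = s := by simpa using e
      have hr' : IsPlain r := (hr.inter hs).mono (by grind)
      exact .inr ⟨c₀, r, rfl, by simp [hc₀, hr'], .refl⟩
    · exact isGenuine_restart
  · obtain ⟨r', rfl, hr'⟩ := step_node (by grind) (by grind) hr hv
    exact .inl ⟨r', s, rfl, hr', hs⟩
  · obtain ⟨s', rfl, hs'⟩ := step_node (by grind) (by grind) hs hv
    exact .inl ⟨r, s', rfl, hr, hs'⟩

theorem IsGenuine.of_step_check (H : ¬ Accepts ms c₀ h) {c w u : verifier.GroundTerm}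
    (hcw : IsPlain (node c w)) (hc : ReflTransGen (PlainStep ms) c₀ c)
    (hu : (system ms c₀ h).Step (check (node c w) (node c w)) u) : IsGenuine ms c₀ u := by
  rcases TRS.step_bin hu with hroot | ⟨_, hs, -⟩ | ⟨_, hs, -⟩
  · rcases rootStep_check hroot with ⟨ρ, hρ, σ, x, y, z, e, e', rfl⟩ | rfl | ⟨σ, x, e⟩
    · simp only [Term.bin_inj, true_and] at e e'
      obtain ⟨⟨rfl, rfl⟩, rfl, rfl⟩ := And.intro e e'
      have hw : IsPlain (node (ρ.2.subst σ) x) := (Term.isOver_bin.1 hcw).2.2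
      exact .inr ⟨_, _, rfl, hw, hc.tail ⟨(Term.isOver_bin.1 hw).2.1, ρ, hρ, σ, rfl, rfl⟩⟩
    · exact isGenuine_restart
    · simp only [Term.bin_inj, true_and] at e
      exact absurd ⟨σ, e.1 ▸ hc⟩ H
  · exact absurd hs (not_step_of_isPlain hcw)
  · exact absurd hs (not_step_of_isPlain hcw)

theorem isGenuine_of_reach (hc₀ : IsPlain c₀) (H : ¬ Accepts ms c₀ h) {t : verifier.GroundTerm}
    (ht : ReflTransGen (system ms c₀ h).Step (restart c₀) t) : IsGenuine ms c₀ t := by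
  induction ht with
  | refl => exact isGenuine_restart
  | tail _ htu ih =>
    rcases ih with ⟨r, s, rfl, hr, hs⟩ | ⟨c, w, rfl, hcw, hc⟩
    · exact .of_step_start hc₀ hr hs htu
    · exact .of_step_check H hcw hc htu

/-- Natural numbers as terms. -/
def num : ℕ → verifier.Term V
  | 0 => leaf
  | n + 1 => node leaf (num n)

theorem isPlain_num (n : ℕ) : IsPlain (num n : verifier.Term V) := by
  induction n with
  | zero => simp [num]
  | succ n ih => simp [num, ih]

@[simp] theorem num_inj {m n : ℕ} : (num m : verifier.Term V) = num n ↔ m = n := by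
  induction m generalizing n <;> cases n <;> simp_all [num]

theorem accepts_of_preserves (hc₀ : IsPlain c₀)
    (hP : (system ms c₀ h).PreservesFiniteRecognizability) : Accepts ms c₀ h := by
  by_contra H
  obtain ⟨A, _, φ, hφ, hL⟩ := recognizable_iff.1 (hP {restart c₀} (Set.finite_singleton _))
  obtain ⟨m, n, hmn, e⟩ := Finite.exists_ne_map_eq_of_infinite fun n => φ (node c₀ (num n))
  have hm : check (node c₀ (num m)) (node c₀ (num m)) ∈ (system ms c₀ h).descendants {restart c₀} :=
    ⟨_, rfl, restart_reach_check (isPlain_num m)⟩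
  obtain ⟨_, rfl, hr⟩ := hL _ (check (node c₀ (num m)) (node c₀ (num n)))
    (hφ 6 _ _ fun i => (Fin.forall_fin_two (p := fun j =>
      φ (![node c₀ (num m), node c₀ (num m)] j) = φ (![node c₀ (num m), node c₀ (num n)] j))).2
        ⟨rfl, e⟩ i) hm
  rcases isGenuine_of_reach hc₀ H hr with ⟨r, s, e, -⟩ | ⟨c, w, e, -⟩
  · simp at e
  · have : num m = w ∧ num n = w := by simp_all
    exact hmn (num_inj.1 (this.1.trans this.2.symm))

theorem preserves_iff_accepts (hc₀ : IsPlain c₀) :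
    (system ms c₀ h).PreservesFiniteRecognizability ↔ Accepts ms c₀ h :=
  ⟨accepts_of_preserves hc₀, preserves_of_accepts⟩

end Nonrecognizability

section Evaluator

open Turing.ToPartrec (Code Cont)

/-- The state of an evaluator for `Code`: either `c` is to be evaluated at `v`, or `v` has just been
computed, and the continuation `k` comes next. In contrast to `Turing.ToPartrec.Cfg`, evaluating a
code takes several steps, so that each step is an instance of one of finitely many rules. -/
inductive Config
  | normal (c : Code) (k : Cont) (v : List ℕ)
  | ret (k : Cont) (v : List ℕ)

namespace Config

/-- One step of the evaluator. -/
def next : Config → Option Config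
  | normal .zero' k v => some (ret k (0 :: v))
  | normal .succ k [] => some (ret k [1])
  | normal .succ k (n :: _) => some (ret k [n + 1])
  | normal .tail k [] => some (ret k [])
  | normal .tail k (_ :: v) => some (ret k v)
  | normal (.cons f g) k v => some (normal f (.cons₁ g v k) v)
  | normal (.comp f g) k v => some (normal g (.comp f k) v)
  | normal (.case f _) k [] => some (normal f k [])
  | normal (.case f _) k (0 :: v) => some (normal f k v)
  | normal (.case _ g) k ((n + 1) :: v) => some (normal g k (n :: v))
  | normal (.fix f) k v => some (normal f (.fix f k) v)
  | ret .halt _ => none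
  | ret (.cons₁ g w k) v => some (normal g (.cons₂ v k) w)
  | ret (.cons₂ [] k) v => some (ret k (0 :: v))
  | ret (.cons₂ (n :: _) k) v => some (ret k (n :: v))
  | ret (.comp f k) v => some (normal f k v)
  | ret (.fix _ k) [] => some (ret k [])
  | ret (.fix _ k) (0 :: v) => some (ret k v)
  | ret (.fix f k) ((_ + 1) :: v) => some (normal f (.fix f k) v)

/-- The result of running the evaluator. -/
def result : Config → Part (List ℕ)
  | normal c k v => (c.eval v).bind k.eval
  | ret k v => k.eval v

theorem mem_eval_fix {f : Code} {v u : List ℕ} : u ∈ f.fix.eval v ↔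
    ∃ w ∈ f.eval v, w.headI = 0 ∧ u = w.tail ∨ w.headI ≠ 0 ∧ u ∈ f.fix.eval w.tail := by
  simp only [Code.fix_eval]
  refine PFun.mem_fix_iff.trans ?_
  simp only [Part.mem_map_iff]
  constructor
  · grind
  · rintro ⟨w, hw, ⟨hw0, rfl⟩ | h⟩
    · exact .inl ⟨w, hw, if_pos hw0⟩
    · exact .inr ⟨w.tail, ⟨w, hw, if_neg h.1⟩, h.2⟩

theorem eval_fix (f : Code) (v : List ℕ) : f.fix.eval v =
    (f.eval v).bind fun w => if w.headI = 0 then .some w.tail else f.fix.eval w.tail := by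
  ext u
  refine mem_eval_fix.trans (Iff.trans ?_ Part.mem_bind_iff.symm)
  refine exists_congr fun w => and_congr_right fun _ => ?_
  split_ifs <;> simp [*]

theorem result_normal_fix (f : Code) (k : Cont) (v : List ℕ) :
    (normal f.fix k v).result = (normal f (.fix f k) v).result := by
  refine (congrArg (Part.bind · k.eval) (eval_fix f v)).trans ((Part.bind_assoc _ _ _).trans ?_)
  refine congrArg (Part.bind _) (funext fun w => ?_)
  dsimp only [Cont.eval]
  split_ifs
  · exact Part.bind_some _ _
  · rfl

theorem result_eq_of_next {x y : Config} (hxy : x.next = some y) : x.result = y.result := by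
  revert hxy
  fun_cases next x <;> rintro ⟨⟩
  case case6 f g k v =>
    refine (Part.bind_assoc ..).trans (congrArg (Part.bind _) (funext fun _ => ?_))
    exact (Part.bind_assoc ..).trans (congrArg (Part.bind _) (funext fun _ => Part.bind_some ..))
  case case11 => exact result_normal_fix ..
  case case19 => exact result_normal_fix ..
  all_goals first | rfl | exact Part.bind_some .. | exact Part.bind_assoc ..

/-- The evaluator moves from the first state to the second one. -/
abbrev Reaches : Config → Config → Prop := ReflTransGen fun x y => x.next = some y

theorem result_eq_of_reaches {x y : Config} (hxy : Reaches x y) : x.result = y.result := by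
  induction hxy with
  | refl => rfl
  | tail _ hyz ih => exact ih.trans (result_eq_of_next hyz)

theorem reaches_of_mem_eval_fix {f : Code} {k : Cont} {v w : List ℕ}
    (hf : ∀ {v w : List ℕ}, w ∈ f.eval v → Reaches (normal f (.fix f k) v) (ret (.fix f k) w))
    (hw : w ∈ f.fix.eval v) : Reaches (normal f (.fix f k) v) (ret k w) := by
  simp only [Code.fix_eval] at hw
  refine PFun.fixInduction' hw (fun v hv => ?_) fun v v' _ hv ih => ?_
  · obtain ⟨u, hu, e⟩ := (Part.mem_map_iff _).1 hv
    refine (hf hu).tail ?_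
    rcases u with _ | ⟨_ | n, u⟩ <;> cases e <;> rfl
  · obtain ⟨u, hu, e⟩ := (Part.mem_map_iff _).1 hv
    refine (hf hu).trans (.head ?_ ih)
    rcases u with _ | ⟨_ | n, u⟩
    · cases e
    · cases e
    · cases e
      rfl

theorem reaches_of_mem_eval {c : Code} {v w : List ℕ} (hw : w ∈ c.eval v) (k : Cont) :
    Reaches (normal c k v) (ret k w) := by
  induction c generalizing v w k with
  | zero' =>
    obtain rfl := Part.mem_some_iff.1 hw
    exact .single rfl
  | succ | tail =>
    obtain rfl := Part.mem_some_iff.1 hw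
    cases v <;> exact .single rfl
  | cons f g ihf ihg =>
    obtain ⟨a, ha, hw⟩ := Part.mem_bind_iff.1 hw
    obtain ⟨b, hb, hw⟩ := Part.mem_bind_iff.1 hw
    obtain rfl := Part.mem_some_iff.1 hw
    refine .trans (.head rfl (ihf ha _)) (.trans (.head rfl (ihg hb _)) (.single ?_))
    cases a <;> rfl
  | comp f g ihf ihg =>
    obtain ⟨a, ha, hw⟩ := Part.mem_bind_iff.1 hw
    exact .trans (.head rfl (ihg ha _)) (.head rfl (ihf hw k))
  | case f g ihf ihg =>
    rcases v with _ | ⟨_ | n, v⟩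
    · exact .head rfl (ihf hw k)
    · exact .head rfl (ihf hw k)
    · exact .head rfl (ihg hw k)
  | fix f ih => exact .head rfl (reaches_of_mem_eval_fix (fun hu => ih hu _) hw)

theorem dom_eval_iff {c : Code} {v : List ℕ} :
    (c.eval v).Dom ↔ ∃ w, Reaches (normal c .halt v) (ret .halt w) := by
  rw [Part.dom_iff_mem]
  refine exists_congr fun w => ⟨fun hw => reaches_of_mem_eval hw _, fun h => ?_⟩
  have : (c.eval v).bind .some = .some w := result_eq_of_reaches h
  exact (Part.bind_some_right _).symm.trans this ▸ Part.mem_some w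

end Config
/-- The pair of the number `k` and `t`, used to encode the `k`-th constructor of a datatype. -/
def tagged (k : ℕ) (t : verifier.Term V) : verifier.Term V := node (num k) t

/-- The code of the state in which the code `c` is to be evaluated at `v` before `k`. -/
def normalTerm (c k v : verifier.Term V) : verifier.Term V := tagged 0 (node c (node k v))

/-- The code of the state in which `v` is passed to the continuation `k`. -/
def retTerm (k v : verifier.Term V) : verifier.Term V := tagged 1 (node k v)

/-- The lists of numbers as terms. -/
def encodeList : List ℕ → verifier.GroundTerm
  | [] => leaf
  | n :: v => node (num n) (encodeList v)

/-- The codes of partial functions as terms. -/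
def encodeCode : Code → verifier.GroundTerm
  | .zero' => tagged 0 leaf
  | .succ => tagged 1 leaf
  | .tail => tagged 2 leaf
  | .cons f g => tagged 3 (node (encodeCode f) (encodeCode g))
  | .comp f g => tagged 4 (node (encodeCode f) (encodeCode g))
  | .case f g => tagged 5 (node (encodeCode f) (encodeCode g))
  | .fix f => tagged 6 (encodeCode f)

/-- The continuations as terms. -/
def encodeCont : Cont → verifier.GroundTerm
  | .halt => tagged 0 leaf
  | .cons₁ g w k => tagged 1 (node (encodeCode g) (node (encodeList w) (encodeCont k)))
  | .cons₂ w k => tagged 2 (node (encodeList w) (encodeCont k))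
  | .comp f k => tagged 3 (node (encodeCode f) (encodeCont k))
  | .fix f k => tagged 4 (node (encodeCode f) (encodeCont k))

namespace Config

/-- The states of the evaluator as terms. -/
def encode : Config → verifier.GroundTerm
  | normal c k v => normalTerm (encodeCode c) (encodeCont k) (encodeList v)
  | ret k v => retTerm (encodeCont k) (encodeList v)

end Config

theorem isPlain_leaf : IsPlain (leaf : verifier.Term V) := by
  simp

theorem isPlain_node {s t : verifier.Term V} (hs : IsPlain s) (ht : IsPlain t) :
    IsPlain (node s t) :=
  Term.isOver_bin.2 ⟨by simp, hs, ht⟩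

theorem isPlain_tagged (k : ℕ) {t : verifier.Term V} (ht : IsPlain t) : IsPlain (tagged k t) :=
  isPlain_node (isPlain_num k) ht

theorem isPlain_encodeList : ∀ v : List ℕ, IsPlain (encodeList v)
  | [] => isPlain_leaf
  | n :: v => isPlain_node (isPlain_num n) (isPlain_encodeList v)

theorem isPlain_encodeCode : ∀ c : Code, IsPlain (encodeCode c)
  | .zero' | .succ | .tail => isPlain_tagged _ isPlain_leaf
  | .cons f g | .comp f g | .case f g =>
    isPlain_tagged _ (isPlain_node (isPlain_encodeCode f) (isPlain_encodeCode g))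
  | .fix f => isPlain_tagged _ (isPlain_encodeCode f)

theorem isPlain_encodeCont : ∀ k : Cont, IsPlain (encodeCont k)
  | .halt => isPlain_tagged _ isPlain_leaf
  | .cons₁ g w k => isPlain_tagged _ (isPlain_node (isPlain_encodeCode g)
      (isPlain_node (isPlain_encodeList w) (isPlain_encodeCont k)))
  | .cons₂ w k => isPlain_tagged _ (isPlain_node (isPlain_encodeList w) (isPlain_encodeCont k))
  | .comp f k | .fix f k =>
    isPlain_tagged _ (isPlain_node (isPlain_encodeCode f) (isPlain_encodeCont k))

theorem Config.isPlain_encode : ∀ x : Config, IsPlain x.encode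
  | normal c k v => isPlain_tagged _ (isPlain_node (isPlain_encodeCode c)
      (isPlain_node (isPlain_encodeCont k) (isPlain_encodeList v)))
  | ret k v => isPlain_tagged _ (isPlain_node (isPlain_encodeCont k) (isPlain_encodeList v))

@[simp] theorem subst_num (σ : V → verifier.Term W) (n : ℕ) :
    (num n : verifier.Term V).subst σ = num n := by
  induction n with
  | zero => exact Term.subst_const σ
  | succ n ih => simp [num, ih]

@[simp] theorem subst_tagged (σ : V → verifier.Term W) (k : ℕ) (t : verifier.Term V) :
    (tagged k t).subst σ = tagged k (t.subst σ) := by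
  simp [tagged]

@[simp] theorem tagged_inj {k l : ℕ} {s t : verifier.Term V} :
    tagged k s = tagged l t ↔ k = l ∧ s = t := by
  simp [tagged]

/-- The steps of the evaluator as rules. -/
def evaluatorRules : List verifier.Rule :=
  [(normalTerm (tagged 0 leaf) (.var 0) (.var 1), retTerm (.var 0) (node leaf (.var 1))),
   (normalTerm (tagged 1 leaf) (.var 0) leaf, retTerm (.var 0) (node (node leaf leaf) leaf)),
   (normalTerm (tagged 1 leaf) (.var 0) (node (.var 1) (.var 2)),
     retTerm (.var 0) (node (node leaf (.var 1)) leaf)),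
   (normalTerm (tagged 2 leaf) (.var 0) leaf, retTerm (.var 0) leaf),
   (normalTerm (tagged 2 leaf) (.var 0) (node (.var 1) (.var 2)), retTerm (.var 0) (.var 2)),
   (normalTerm (tagged 3 (node (.var 0) (.var 1))) (.var 2) (.var 3),
     normalTerm (.var 0) (tagged 1 (node (.var 1) (node (.var 3) (.var 2)))) (.var 3)),
   (normalTerm (tagged 4 (node (.var 0) (.var 1))) (.var 2) (.var 3),
     normalTerm (.var 1) (tagged 3 (node (.var 0) (.var 2))) (.var 3)),
   (normalTerm (tagged 5 (node (.var 0) (.var 1))) (.var 2) leaf,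
     normalTerm (.var 0) (.var 2) leaf),
   (normalTerm (tagged 5 (node (.var 0) (.var 1))) (.var 2) (node leaf (.var 3)),
     normalTerm (.var 0) (.var 2) (.var 3)),
   (normalTerm (tagged 5 (node (.var 0) (.var 1))) (.var 2) (node (node leaf (.var 4)) (.var 3)),
     normalTerm (.var 1) (.var 2) (node (.var 4) (.var 3))),
   (normalTerm (tagged 6 (.var 0)) (.var 1) (.var 2),
     normalTerm (.var 0) (tagged 4 (node (.var 0) (.var 1))) (.var 2)),
   (retTerm (tagged 1 (node (.var 0) (node (.var 1) (.var 2)))) (.var 3),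
     normalTerm (.var 0) (tagged 2 (node (.var 3) (.var 2))) (.var 1)),
   (retTerm (tagged 2 (node leaf (.var 0))) (.var 1), retTerm (.var 0) (node leaf (.var 1))),
   (retTerm (tagged 2 (node (node (.var 2) (.var 3)) (.var 0))) (.var 1),
     retTerm (.var 0) (node (.var 2) (.var 1))),
   (retTerm (tagged 3 (node (.var 0) (.var 1))) (.var 2),
     normalTerm (.var 0) (.var 1) (.var 2)),
   (retTerm (tagged 4 (node (.var 0) (.var 1))) leaf, retTerm (.var 1) leaf),
   (retTerm (tagged 4 (node (.var 0) (.var 1))) (node leaf (.var 2)),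
     retTerm (.var 1) (.var 2)),
   (retTerm (tagged 4 (node (.var 0) (.var 1))) (node (node leaf (.var 3)) (.var 2)),
     normalTerm (.var 0) (tagged 4 (node (.var 0) (.var 1))) (.var 2))]

theorem rootStep_of_exists {P : Set verifier.Rule} {t u : verifier.GroundTerm}
    (h : ∃ ρ ∈ P, ∃ a b c d e : verifier.GroundTerm,
      ρ.1.subst (fun i => [a, b, c, d, e].getD i leaf) = t ∧
        ρ.2.subst (fun i => [a, b, c, d, e].getD i leaf) = u) : RootStep P t u := by
  obtain ⟨ρ, hρ, a, b, c, d, e, h⟩ := h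
  exact ⟨ρ, hρ, _, h⟩

namespace Config

theorem rootStep_encode {x y : Config} (hxy : x.next = some y) :
    RootStep {ρ | ρ ∈ evaluatorRules} x.encode y.encode := by
  have : Nonempty verifier.GroundTerm := ⟨leaf⟩
  refine rootStep_of_exists ?_
  revert hxy
  fun_cases next x <;> rintro ⟨⟩
  all_goals
    simp only [evaluatorRules, Set.mem_ofPred_eq, List.mem_cons, List.not_mem_nil, or_false,
      or_and_right, exists_or, exists_eq_left, encode, encodeCode, encodeCont, encodeList,
      normalTerm, retTerm, num, subst_tagged, Term.subst_bin, Term.subst_const, Term.subst_var,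
      tagged_inj, Term.bin_inj, Term.const_ne_bin, Term.bin_ne_const, Nat.reduceEqDiff,
      OfNat.ofNat_ne_zero, zero_ne_one, one_ne_zero, false_and, and_false, true_and, and_true,
      exists_false, false_or]
  all_goals simp

theorem exists_next_of_rootStep_encode {x : Config} {t : verifier.GroundTerm}
    (ht : RootStep {ρ | ρ ∈ evaluatorRules} x.encode t) : ∃ y, x.next = some y ∧ y.encode = t := by
  obtain ⟨ρ, hρ, σ, e, rfl⟩ := ht
  revert e
  simp only [evaluatorRules, Set.mem_ofPred_eq, List.mem_cons, List.not_mem_nil, or_false] at hρ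
  rcases hρ with rfl | rfl | rfl | rfl | rfl | rfl | rfl | rfl | rfl | rfl | rfl | rfl | rfl |
    rfl | rfl | rfl | rfl | rfl
  all_goals
    fun_cases next x
  all_goals
    simp only [encode, encodeCode, encodeCont, encodeList, normalTerm, retTerm, num, subst_tagged,
      Term.subst_bin, Term.subst_const, Term.subst_var, tagged_inj, Term.bin_inj,
      Term.const_ne_bin, Term.bin_ne_const, Nat.reduceEqDiff, false_and, and_false, true_and,
      and_true, false_implies, OfNat.ofNat_ne_zero, zero_ne_one, one_ne_zero]
  all_goals
    intro e
    exact ⟨_, rfl, by simp [encodeCont, encodeList, num, e]⟩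

end Config

/-- The pattern of the codes of the states in which the evaluator halts. -/
def haltPattern : verifier.Term ℕ := retTerm (tagged 0 leaf) (.var 0)

theorem subst_haltPattern (σ : ℕ → verifier.GroundTerm) :
    haltPattern.subst σ = retTerm (encodeCont .halt) (σ 0) := by
  simp [haltPattern, retTerm, encodeCont]

theorem Config.exists_reaches_of_plainStep {x : Config} {t : verifier.GroundTerm}
    (ht : ReflTransGen (PlainStep evaluatorRules) x.encode t) :
    ∃ y, Reaches x y ∧ y.encode = t := by
  induction ht with
  | refl => exact ⟨x, .refl, rfl⟩
  | tail _ hst ih =>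
    obtain ⟨y, hxy, rfl⟩ := ih
    obtain ⟨z, hyz, rfl⟩ := exists_next_of_rootStep_encode hst.2
    exact ⟨z, hxy.tail hyz, rfl⟩

theorem Config.eq_ret_of_encode_eq {x : Config} {t : verifier.GroundTerm}
    (h : x.encode = retTerm (encodeCont .halt) t) : ∃ w, x = ret .halt w := by
  rcases x with ⟨c, k, v⟩ | ⟨k | _, v⟩ <;> simp_all [encode, normalTerm, retTerm, encodeCont]

theorem accepts_evaluatorRules_iff {c : Code} {v : List ℕ} :
    Accepts evaluatorRules (Config.normal c .halt v).encode haltPattern ↔ (c.eval v).Dom := by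
  rw [Config.dom_eval_iff]
  constructor
  · rintro ⟨σ, hσ⟩
    obtain ⟨x, hx, e⟩ := Config.exists_reaches_of_plainStep hσ
    obtain ⟨w, rfl⟩ := Config.eq_ret_of_encode_eq (e.trans (subst_haltPattern σ))
    exact ⟨w, hx⟩
  · rintro ⟨w, hw⟩
    refine ⟨fun _ => encodeList w, ?_⟩
    rw [subst_haltPattern]
    exact hw.lift Config.encode fun _ y hxy => ⟨y.isPlain_encode, Config.rootStep_encode hxy⟩

section Computability

variable {α : Type*} [Primcodable α]

theorem primrec_code_bin {F : RankedAlphabet} {p : Fin F.size} {hp : F.rank p = 2}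
    {s t : α → F.Term ℕ} (hs : Primrec fun a => (s a).code) (ht : Primrec fun a => (t a).code) :
    Primrec fun a => (Term.bin p hp (s a) (t a)).code :=
  (Primrec.list_cons.comp (.const _) (Primrec.list_append.comp hs ht)).of_eq fun _ =>
    (Term.code_bin _ _).symm

theorem primrec_code_num : Primrec fun n => (num n : verifier.Term ℕ).code := by
  have step : Primrec₂ fun (_ : ℕ) (w : List (ℕ ⊕ ℕ)) => Sum.inr 4 :: Sum.inr 0 :: w :=
    Primrec.list_cons.comp₂ (.const _) (Primrec.list_cons.comp₂ (.const _) .right)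
  refine (Primrec.nat_rec₁ [Sum.inr 0] step).of_eq fun n => ?_
  induction n with
  | zero =>
    rw [num, Term.code_const]
    rfl
  | succ n ih =>
    rw [num, Term.code_bin, Term.code_const]
    exact congrArg (Sum.inr 4 :: Sum.inr 0 :: ·) ih

theorem primrec_code_encode_normal (c : Code) (k : Cont) : Primrec fun n =>
    (.ofGround (Config.normal c k [n]).encode : verifier.Term ℕ).code := by
  simp only [Config.encode, encodeList, normalTerm, tagged, Term.ofGround, Term.subst_bin,
    Term.subst_const, subst_num]
  exact primrec_code_bin (.const _) (primrec_code_bin (.const _) (primrec_code_bin (.const _)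
    (primrec_code_bin primrec_code_num (.const _))))

theorem primrec_instanceCode (ms : List verifier.Rule) (h : verifier.Term ℕ)
    {c₀ : α → verifier.GroundTerm}
    (hc₀ : Primrec fun a => (.ofGround (c₀ a) : verifier.Term ℕ).code) :
    Primrec fun a => verifier.instanceCode (systemRules ms (c₀ a) h) := by
  have hrestart : Primrec fun a => (.ofGround (restart (c₀ a)) : verifier.Term ℕ).code := by
    simp only [restart, Term.ofGround_bin, Term.ofGround_const]
    exact primrec_code_bin (primrec_code_bin hc₀ (.const _)) (primrec_code_bin hc₀ (.const _))
  simp only [instanceCode, systemRules, rightGroundRules, List.map_append, List.map_cons]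
  exact .pair (.const _) (Primrec.list_append.comp (.const _) (Primrec.list_cons.comp
    (.pair (.const _) hrestart) (Primrec.list_cons.comp (.pair (.const _) hrestart) (.const _))))

theorem exists_code_not_computablePred_dom :
    ∃ c : Code, ¬ ComputablePred fun n : ℕ => (c.eval [n]).Dom := by
  have hf : Partrec fun n : ℕ => (Denumerable.ofNat Nat.Partrec.Code n).eval 0 :=
    Nat.Partrec.Code.eval_part.comp (Computable.ofNat _) (Computable.const 0)
  obtain ⟨c, hc⟩ := Code.exists_code (Nat.Partrec'.part_iff₁.2 hf)
  refine ⟨c, fun hcomp => ComputablePred.halting_problem 0 (hcomp.computable_of_manyOneReducible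
    ⟨Encodable.encode, Computable.encode, fun d => ?_⟩)⟩
  have hd : c.eval [Encodable.encode d] =
      pure <$> (Denumerable.ofNat Nat.Partrec.Code (Encodable.encode d)).eval 0 :=
    hc ⟨[Encodable.encode d], rfl⟩
  rw [hd, Denumerable.ofNat_encode]
  rfl

end Computability

end Evaluator

end verifier

end RankedAlphabet

open RankedAlphabet RankedAlphabet.verifier in
theorem mainTheorem10_general :
    ∃ F : RankedAlphabet, ¬ ∃ P : RankedAlphabet.InstanceCode → Prop, ComputablePred P ∧
      ∀ (R : F.TRS) (rs : List F.Rule), (∀ ρ, ρ ∈ rs ↔ ρ ∈ R.rules) → R.IsMurg →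
        (P (F.instanceCode rs) ↔ R.PreservesFiniteRecognizability) := by
  refine ⟨verifier, fun ⟨P, hP, hPR⟩ => ?_⟩
  obtain ⟨c, hc⟩ := exists_code_not_computablePred_dom
  let initial (n : ℕ) := (Config.normal c .halt [n]).encode
  refine hc (hP.computable_of_manyOneReducible
    ⟨fun n => verifier.instanceCode (systemRules evaluatorRules (initial n) haltPattern),
      (primrec_instanceCode _ _ (primrec_code_encode_normal c .halt)).to_comp, fun n => ?_⟩)
  rw [hPR (system evaluatorRules (initial n) haltPattern) _ (fun _ => .rfl) (isMurg_system ..),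
    preserves_iff_accepts (Config.isPlain_encode _), accepts_evaluatorRules_iff]

/-- No computable predicate on inputs answers correctly, on every listing of the rules of every
murg TRS `R` over every ranked alphabet `F`, whether `R` preserves `F`-recognizability of finite
tree languages. -/
theorem mainTheorem10 :
    ¬ ∃ P : RankedAlphabet.InstanceCode → Prop, ComputablePred P ∧
      ∀ (F : RankedAlphabet) (R : F.TRS) (rs : List F.Rule),
        (∀ ρ, ρ ∈ rs ↔ ρ ∈ R.rules) → R.IsMurg →
          (P (F.instanceCode rs) ↔ R.PreservesFiniteRecognizability) :=
  let ⟨F, hF⟩ := mainTheorem10_general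
  fun ⟨P, hP, hPR⟩ => hF ⟨P, hP, hPR F⟩
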